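/- Let $\mathbb H^2$ be the hyperbolic plane and equip $\mathbb H^2\times\mathbb R$ with the Riemannian product metric. A geodesic of a Riemannian manifold is the image of a locally isometric (that is, locally distance-preserving) map from the whole real line $\mathbb R$ into it. A totally geodesic subset is a nonempty subset $S$ such that for any $p,q\in S$ (possibly equal) there is a geodesic that contains $p$ and $q$ and lies entirely in $S$; no topological or smooth structure on $S$ is assumed. It is called nontrivial if it is neither a geodesic nor the entire space. Every nontrivial totally geodesic subset of $\mathbb H^2\times\mathbb R$ is either a horizontal plane $\mathbb H^2\times\{r\}$ for some $r\in\mathbb R$, or a vertical plane $\gamma\times\mathbb R$ for some geodesic $\gamma$ of $\mathbb H^2$. Conversely, all of these planes are nontrivial totally geodesic subsets. -/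

import Mathlib

open scoped UpperHalfPlane

/-- `H² × ℝ`: the product of the hyperbolic plane (upper half-plane with the Poincaré distance of
curvature `-1`) and the real line. The type synonym `WithLp 2` carries the distance
`√(dist z w ^ 2 + dist s t ^ 2)`, which is the distance of the Riemannian product metric. -/
abbrev HypTimesReal : Type := WithLp 2 (ℍ × ℝ)

/-- `c : ℝ → X` is locally isometric: around each parameter it preserves distances. -/
def IsLocallyIsometric {X : Type*} [MetricSpace X] (c : ℝ → X) : Prop :=
  ∀ t : ℝ, ∃ ε > 0, ∀ s ∈ Metric.ball t ε, ∀ s' ∈ Metric.ball t ε, dist (c s) (c s') = dist s s'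

/-- A (complete) geodesic, as a set: the image of a locally isometric map from the real line. -/
def IsGeodesic {X : Type*} [MetricSpace X] (G : Set X) : Prop :=
  ∃ c : ℝ → X, IsLocallyIsometric c ∧ G = Set.range c

/-- A nonempty set such that any two of its points (distinct or not) lie on a complete geodesic
contained in the set. No topological or smooth structure on the set is assumed. -/
def IsTotallyGeodesic {X : Type*} [MetricSpace X] (S : Set X) : Prop :=
  S.Nonempty ∧ ∀ p ∈ S, ∀ q ∈ S, ∃ G : Set X, IsGeodesic G ∧ p ∈ G ∧ q ∈ G ∧ G ⊆ S

/-- A set is trivial if it is a geodesic or the entire space. -/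
def IsTrivialSubset {X : Type*} [MetricSpace X] (S : Set X) : Prop :=
  IsGeodesic S ∨ S = Set.univ

/-- The horizontal plane `H² × {r}`. -/
def horizontalPlane (r : ℝ) : Set HypTimesReal := {x | x.snd = r}

/-- The set `γ × ℝ` over a subset `γ` of `H²`; a vertical plane when `γ` is a geodesic. -/
def verticalOver (γ : Set ℍ) : Set HypTimesReal := {x | x.fst ∈ γ}

/-- The set is a horizontal plane `H² × {r}`. -/
def IsHorizontalPlane (S : Set HypTimesReal) : Prop :=
  ∃ r : ℝ, S = horizontalPlane r

/-- The set is a vertical plane `γ × ℝ` over a geodesic `γ` of `H²`. -/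
def IsVerticalPlane (S : Set HypTimesReal) : Prop :=
  ∃ γ : Set ℍ, IsGeodesic γ ∧ S = verticalOver γ

/-! In ℍ, in ℝ and in their product, segments are unique, do not branch and extend to isometric
lines. Hence local geodesics are global lines, two points lie on only one of them, and a totally
geodesic set S contains every line through two of its points (`IsTotallyGeodesic.closedUnderLines`).
Lines of the product are pairs of affinely parametrized lines of the factors, so the projection of S
to ℍ (`shadow`) is also closed under lines: it has at most one point, or is a geodesic, or is all of
ℍ (`ClosedUnderLines.trichotomy`).

If some vertical fibre of S has two points, prolonging lines makes every nonempty fibre full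
(`fibre_full`), so S is its shadow times ℝ. Otherwise S is a graph over its shadow. A graph over a
geodesic is a geodesic; a graph over ℍ belongs to a function affine along all lines, and curvature
forces such a function to be constant (`eq_of_affine_on_lines`). -/

/-- A point between two given points is determined by its distances to them. -/
def UniqueBetween (X : Type*) [MetricSpace X] : Prop :=
  ∀ a b m m' : X, dist a m + dist m b = dist a b → dist a m' = dist a m → dist m' b = dist m b →
    m' = m

/-- Segments cannot be prolonged in two different ways by the same length. -/
def NonBranching (X : Type*) [MetricSpace X] : Prop :=
  ∀ a m q q' : X, a ≠ m → dist a m + dist m q = dist a q → dist a m + dist m q' = dist a q' →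
    dist m q' = dist m q → q' = q

/-- Any two distinct points lie on an isometrically embedded real line. -/
def HasLines (X : Type*) [MetricSpace X] : Prop :=
  ∀ a b : X, a ≠ b → ∃ c : ℝ → X, Isometry c ∧ a ∈ Set.range c ∧ b ∈ Set.range c

/-- The affine reparametrization of a line sending `0` to `s` and `1` to `u`. -/
def param (s u k : ℝ) : ℝ := s + k * (u - s)

/-! ### Uniqueness of geodesics in abstract metric spaces -/

section Abstract

variable {X : Type*} [MetricSpace X]

theorem Isometry.comp_sub {c : ℝ → X} (hc : Isometry c) (a : ℝ) :
    Isometry fun t => c (t + a) :=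
  Isometry.of_dist_eq fun x y => by rw [hc.dist_eq]; simp

theorem Isometry.comp_neg' {c : ℝ → X} (hc : Isometry c) : Isometry fun t => c (-t) :=
  Isometry.of_dist_eq fun x y => by rw [hc.dist_eq]; simp

theorem Isometry.isLocallyIsometric {c : ℝ → X} (hc : Isometry c) : IsLocallyIsometric c :=
  fun _ => ⟨1, one_pos, fun s _ s' _ => hc.dist_eq s s'⟩

theorem Isometry.isGeodesic_range {c : ℝ → X} (hc : Isometry c) : IsGeodesic (Set.range c) :=
  ⟨c, hc.isLocallyIsometric, rfl⟩

/-- Lines through two points can be parametrized by arc length between prescribed parameters. -/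
theorem HasLines.exists_isometry (hL : HasLines X) {a b : X} {s u : ℝ} (hsu : s ≠ u)
    (h : dist a b = dist s u) : ∃ c : ℝ → X, Isometry c ∧ c s = a ∧ c u = b := by
  have hab : a ≠ b := dist_pos.1 (h ▸ dist_pos.2 hsu)
  obtain ⟨c, hc, ⟨p, rfl⟩, ⟨q, rfl⟩⟩ := hL a b hab
  rw [hc.dist_eq, Real.dist_eq, Real.dist_eq, abs_eq_abs] at h
  rcases h with h | h
  · exact ⟨fun t => c (t + (p - s)), hc.comp_sub _, congrArg c (by ring),
      congrArg c (by linarith)⟩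
  · exact ⟨fun t => c (-(t + (-(p + s)))), hc.comp_neg'.comp_sub _, congrArg c (by ring),
      congrArg c (by linarith)⟩

/-- Two maps that preserve distances on a set of parameters and agree at two of them agree. -/
theorem eqOn_of_isometric (hU : UniqueBetween X) (hN : NonBranching X) {c σ : ℝ → X} {I : Set ℝ}
    (hc : ∀ x ∈ I, ∀ y ∈ I, dist (c x) (c y) = dist x y)
    (hσ : ∀ x ∈ I, ∀ y ∈ I, dist (σ x) (σ y) = dist x y) {s u : ℝ} (hs : s ∈ I) (hu : u ∈ I)
    (hsu : s < u) (h1 : c s = σ s) (h2 : c u = σ u) : Set.EqOn c σ I := by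
  intro w hw
  -- Parameters outside `[s, u]` are reached by non-branching prolongation; those inside by
  -- uniqueness of the point between.
  have key : ∀ x ∈ I, ∀ y ∈ I, c x = σ x → c y = σ y → x ≠ y →
      dist x y + dist y w = dist x w → c w = σ w := by
    intro x hx y hy ex ey hxy h
    refine hN (σ x) (σ y) _ _ ?_ ?_ ?_ ?_
    · rw [← dist_pos, hσ x hx y hy]; exact dist_pos.2 hxy
    · rw [hσ x hx y hy, hσ y hy w hw, hσ x hx w hw, h]
    · rw [hσ x hx y hy, ← ex, ← ey, hc y hy w hw, hc x hx w hw, h]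
    · rw [hσ y hy w hw, ← ey, hc y hy w hw]
  rcases lt_or_ge w s with h | h
  · exact key u hu s hs h2 h1 hsu.ne' (by
      simp only [Real.dist_eq]; rw [abs_of_pos, abs_of_pos, abs_of_pos] <;> linarith)
  rcases lt_or_ge u w with h' | h'
  · exact key s hs u hu h1 h2 hsu.ne (by
      simp only [Real.dist_eq]; rw [abs_of_neg, abs_of_neg, abs_of_neg] <;> linarith)
  · refine hU (σ s) (σ u) _ _ ?_ ?_ ?_
    · rw [hσ s hs w hw, hσ w hw u hu, hσ s hs u hu]
      simp only [Real.dist_eq]; rw [abs_of_nonpos, abs_of_nonpos, abs_of_nonpos] <;> linarith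
    · rw [hσ s hs w hw, ← h1, hc s hs w hw]
    · rw [hσ w hw u hu, ← h2, hc w hw u hu]

/-- Local geodesics are globally distance preserving. -/
theorem IsLocallyIsometric.isometry (hU : UniqueBetween X) (hN : NonBranching X)
    (hL : HasLines X) {c : ℝ → X} (hc : IsLocallyIsometric c) : Isometry c := by
  obtain ⟨ε, hε, h0⟩ := hc 0
  have m0 : (0 : ℝ) ∈ Metric.ball (0 : ℝ) ε := Metric.mem_ball_self hε
  have m1 : ε / 2 ∈ Metric.ball (0 : ℝ) ε := by
    rw [Metric.mem_ball, Real.dist_eq, abs_of_pos] <;> linarith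
  obtain ⟨σ, hσ, e0, e1⟩ := hL.exists_isometry (half_pos hε).ne (h0 _ m0 _ m1)
  -- Agreement near a point is an open condition. It is closed because a ball around a limit point,
  -- on which `c` is isometric, contains a whole interval of agreement, and two common values
  -- suffice on that ball.
  have hcl : IsClopen {t : ℝ | c =ᶠ[nhds t] σ} := by
    refine ⟨?_, isOpen_iff_mem_nhds.2 fun t ht => eventually_eventually_nhds.2 ht⟩
    refine isClosed_of_closure_subset fun t ht => ?_
    obtain ⟨δ, hδ, hloc⟩ := hc t
    obtain ⟨r, hrA, hrt⟩ := Metric.mem_closure_iff.1 ht δ hδ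
    have hr : r ∈ Metric.ball t δ := by rwa [Metric.mem_ball, dist_comm]
    obtain ⟨η, hη, hsub⟩ := Metric.eventually_nhds_iff_ball.1
      (Filter.Eventually.and hrA (Metric.isOpen_ball.mem_nhds hr))
    have n1 : r + η / 2 ∈ Metric.ball r η := by
      rw [Metric.mem_ball, Real.dist_eq, abs_of_pos] <;> linarith
    exact Filter.eventuallyEq_of_mem (Metric.ball_mem_nhds t hδ)
      (eqOn_of_isometric hU hN hloc (fun x _ y _ => hσ.dist_eq x y)
        hr (hsub _ n1).2 (by linarith : r < r + η / 2)
        (hsub _ (Metric.mem_ball_self hη)).1 (hsub _ n1).1)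
  have hne : (0 : ℝ) ∈ {t : ℝ | c =ᶠ[nhds t] σ} :=
    Filter.eventuallyEq_of_mem (Metric.ball_mem_nhds 0 hε)
      (eqOn_of_isometric hU hN h0 (fun x _ y _ => hσ.dist_eq x y) m0 m1 (half_pos hε) e0.symm
        e1.symm)
  have huniv := hcl.eq_univ ⟨0, hne⟩
  have : c = σ := funext fun t =>
    Filter.EventuallyEq.eq_of_nhds (show t ∈ {t : ℝ | c =ᶠ[nhds t] σ} by rw [huniv]; trivial)
  rwa [this]

/-- Two isometric lines sharing two points have the same image. -/
theorem range_eq_of_isometry (hU : UniqueBetween X) (hN : NonBranching X) {c σ : ℝ → X}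
    (hc : Isometry c) (hσ : Isometry σ) {p q : X} (hpq : p ≠ q) (hp : p ∈ Set.range c)
    (hq : q ∈ Set.range c) (hp' : p ∈ Set.range σ) (hq' : q ∈ Set.range σ) :
    Set.range c = Set.range σ := by
  obtain ⟨s, rfl⟩ := hp
  obtain ⟨u, rfl⟩ := hq
  wlog hsu : s < u generalizing s u
  · rcases lt_trichotomy s u with h | h | h
    · exact absurd h hsu
    · exact absurd (congrArg c h) hpq
    · exact this u hq' s hp' hpq.symm h
  -- A translation or a reflection of the parameter of σ matches the two given points.
  have hL : ∃ τ : ℝ → X, Isometry τ ∧ Set.range τ = Set.range σ ∧ τ s = c s ∧ τ u = c u := by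
    obtain ⟨s', hs⟩ := hp'
    obtain ⟨u', hu⟩ := hq'
    have h : dist s' u' = dist s u := by rw [← hσ.dist_eq, hs, hu, hc.dist_eq]
    rw [Real.dist_eq, Real.dist_eq, abs_eq_abs] at h
    rcases h with h | h
    · refine ⟨fun t => σ (t + (s' - s)), hσ.comp_sub _, ?_, ?_, ?_⟩
      · exact (Equiv.addRight (s' - s)).surjective.range_comp σ
      · exact (congrArg σ (by ring)).trans hs
      · exact (congrArg σ (by linarith)).trans hu
    · refine ⟨fun t => σ (-(t + (-(s' + s)))), hσ.comp_neg'.comp_sub _, ?_, ?_, ?_⟩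
      · exact ((Equiv.neg ℝ).surjective.comp (Equiv.addRight (-(s' + s))).surjective).range_comp σ
      · exact (congrArg σ (by ring)).trans hs
      · exact (congrArg σ (by linarith)).trans hu
  obtain ⟨τ, hτ, hr, h1, h2⟩ := hL
  rw [← hr]
  congr 1
  exact funext fun t => eqOn_of_isometric hU hN (fun x _ y _ => hc.dist_eq x y)
    (fun x _ y _ => hτ.dist_eq x y) (Set.mem_univ s) (Set.mem_univ u) hsu h1.symm h2.symm
    (Set.mem_univ t)

/-- A set contains every line through two of its points. -/
def ClosedUnderLines (S : Set X) : Prop :=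
  ∀ c : ℝ → X, Isometry c → ∀ s u : ℝ, s ≠ u → c s ∈ S → c u ∈ S → ∀ t, c t ∈ S

theorem IsTotallyGeodesic.closedUnderLines (hU : UniqueBetween X) (hN : NonBranching X)
    (hL : HasLines X) {S : Set X} (hS : IsTotallyGeodesic S) : ClosedUnderLines S := by
  intro c hc s u hsu h1 h2 t
  obtain ⟨G, ⟨σ, hσ, rfl⟩, hp, hq, hG⟩ := hS.2 _ h1 _ h2
  rw [← range_eq_of_isometry hU hN hc (hσ.isometry hU hN hL) (hc.injective.ne hsu) ⟨s, rfl⟩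
    ⟨u, rfl⟩ hp hq] at hG
  exact hG ⟨t, rfl⟩

/-- A geodesic contains at most two points at a given distance from one of its points. -/
theorem IsGeodesic.not_three_equidistant (hU : UniqueBetween X) (hN : NonBranching X)
    (hL : HasLines X) {G : Set X} (hG : IsGeodesic G) {o p q r : X} (ho : o ∈ G) (hp : p ∈ G)
    (hq : q ∈ G) (hr : r ∈ G) (hpq : p ≠ q) (hqr : q ≠ r) (hpr : p ≠ r)
    (h1 : dist o p = dist o q) (h2 : dist o p = dist o r) : False := by
  obtain ⟨c, hc, rfl⟩ := hG
  have hc := hc.isometry hU hN hL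
  obtain ⟨o, rfl⟩ := ho
  obtain ⟨p, rfl⟩ := hp
  obtain ⟨q, rfl⟩ := hq
  obtain ⟨r, rfl⟩ := hr
  rw [hc.dist_eq, hc.dist_eq, Real.dist_eq, Real.dist_eq, abs_eq_abs] at h1 h2
  have e1 : p ≠ q := fun h => hpq (h ▸ rfl)
  have e2 : q ≠ r := fun h => hqr (h ▸ rfl)
  have e3 : p ≠ r := fun h => hpr (h ▸ rfl)
  rcases h1 with h1 | h1
  · exact e1 (by linarith)
  rcases h2 with h2 | h2
  · exact e3 (by linarith)
  · exact e2 (by linarith)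

end Abstract

/-! ### Lines of ℝ and of the hyperbolic plane -/

theorem uniqueBetween_real : UniqueBetween ℝ := by
  intro a b m m' h h1 h2
  simp only [Real.dist_eq] at *
  grind

theorem nonBranching_real : NonBranching ℝ := by
  intro a m q q' ham h h1 h2
  simp only [Real.dist_eq] at *
  grind

/-- The vertical unit speed line over `x`. -/
noncomputable def vertLine (x t : ℝ) : ℍ := ⟨⟨x, Real.exp t⟩, Real.exp_pos t⟩

/-- The unit speed line whose image is the half circle with centre `c` and radius `exp ρ`. -/
noncomputable def circLine (c ρ t : ℝ) : ℍ :=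
  ⟨⟨c + Real.exp ρ * Real.tanh t, Real.exp ρ / Real.cosh t⟩,
    div_pos (Real.exp_pos ρ) (Real.cosh_pos t)⟩

@[simp] theorem vertLine_re (x t : ℝ) : (vertLine x t).re = x := rfl

@[simp] theorem vertLine_im (x t : ℝ) : (vertLine x t).im = Real.exp t := rfl

@[simp] theorem circLine_re (c ρ t : ℝ) : (circLine c ρ t).re = c + Real.exp ρ * Real.tanh t := rfl

@[simp] theorem circLine_im (c ρ t : ℝ) : (circLine c ρ t).im = Real.exp ρ / Real.cosh t := rfl

theorem isometry_vertLine (x : ℝ) : Isometry (vertLine x) :=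
  UpperHalfPlane.isometry_vertical_line x

theorem isometry_circLine (c ρ : ℝ) : Isometry (circLine c ρ) := by
  refine Isometry.of_dist_eq fun s t => ?_
  have h : Real.cosh (dist (circLine c ρ s) (circLine c ρ t)) = Real.cosh (s - t) := by
    rw [UpperHalfPlane.cosh_dist', Real.cosh_sub]
    simp only [circLine_re, circLine_im, Real.tanh_eq_sinh_div_cosh]
    have h1 := Real.cosh_sq s
    have h2 := Real.cosh_sq t
    have := (Real.cosh_pos s).ne'
    have := (Real.cosh_pos t).ne'
    have := (Real.exp_pos ρ).ne'
    field_simp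
    linear_combination -Real.exp ρ ^ 2 * (Real.cosh t ^ 2 * h1 + Real.cosh s ^ 2 * h2)
  rw [Real.dist_eq, ← abs_of_nonneg (dist_nonneg (x := circLine c ρ s) (y := circLine c ρ t))]
  exact le_antisymm (Real.cosh_le_cosh.1 h.le) (Real.cosh_le_cosh.1 h.ge)

namespace UpperHalfPlane

/-- The squared Euclidean norm of a point of the upper half-plane. -/
def sqNorm (z : ℍ) : ℝ := z.re ^ 2 + z.im ^ 2

theorem mem_range_vertLine {x : ℝ} {z : ℍ} (h : z.re = x) : z ∈ Set.range (vertLine x) :=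
  ⟨Real.log z.im, ext_re_im (by simp [h]) (by simp [Real.exp_log z.im_pos])⟩

theorem mem_range_circLine {c ρ : ℝ} {z : ℍ} (h : sqNorm z - 2 * c * z.re = Real.exp ρ ^ 2 - c ^ 2) :
    z ∈ Set.range (circLine c ρ) := by
  have hy := z.im_pos
  have hc : Real.cosh (Real.arsinh ((z.re - c) / z.im)) = Real.exp ρ / z.im := by
    rw [Real.cosh_arsinh, Real.sqrt_eq_iff_mul_self_eq (by positivity) (by positivity)]
    field_simp
    unfold sqNorm at h
    linarith
  -- Along `circLine c ρ` the quotient `(re - c) / im` equals `sinh t`.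
  refine ⟨Real.arsinh ((z.re - c) / z.im), ext_re_im ?_ ?_⟩
  · have := Real.exp_pos ρ
    rw [circLine_re, Real.tanh_eq_sinh_div_cosh, hc, Real.sinh_arsinh]
    field_simp
    ring
  · have := Real.exp_pos ρ
    rw [circLine_im, hc]
    field_simp

/-- Collinearity, expressed through the points `(re z, |z| ^ 2)` of the plane. -/
def Collinear3 (a b q : ℍ) : Prop :=
  (b.re - a.re) * (sqNorm q - sqNorm a) = (q.re - a.re) * (sqNorm b - sqNorm a)

/-- In the coordinates `(re z, |z|²)` half circles centred at `c` have the linear equation `|z|² -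
2c re z = const`, and vertical lines stay vertical. ℍ becomes the region above the parabola, and its
geodesics become the traces of straight lines there. -/
theorem exists_line {a b : ℍ} (hab : a ≠ b) : ∃ c : ℝ → ℍ, Isometry c ∧ a ∈ Set.range c ∧
    b ∈ Set.range c ∧ ∀ q, Collinear3 a b q → q ∈ Set.range c := by
  by_cases hx : a.re = b.re
  · refine ⟨vertLine a.re, isometry_vertLine _, mem_range_vertLine rfl, mem_range_vertLine hx.symm,
      fun q hq => mem_range_vertLine ?_⟩
    unfold Collinear3 at hq
    rw [← hx, sub_self, zero_mul, zero_eq_mul] at hq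
    rcases hq with hq | hq
    · linarith
    · refine absurd (ext_re_im hx ?_) hab
      unfold sqNorm at hq
      rw [hx] at hq
      have : b.im ^ 2 = a.im ^ 2 := by linarith
      exact ((pow_left_inj₀ b.im_pos.le a.im_pos.le two_ne_zero).1 this).symm
  · have hx' : b.re - a.re ≠ 0 := sub_ne_zero.2 (Ne.symm hx)
    set c : ℝ := (sqNorm b - sqNorm a) / (2 * (b.re - a.re)) with hc
    have hc' : 2 * c * (b.re - a.re) = sqNorm b - sqNorm a := by rw [hc]; field_simp
    have hpos : 0 < sqNorm a - 2 * c * a.re + c ^ 2 := by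
      have := a.im_pos
      have : sqNorm a - 2 * c * a.re + c ^ 2 = (a.re - c) ^ 2 + a.im ^ 2 := by
        unfold sqNorm; ring
      rw [this]; positivity
    have hρ : Real.exp (Real.log √(sqNorm a - 2 * c * a.re + c ^ 2)) ^ 2 =
        sqNorm a - 2 * c * a.re + c ^ 2 := by
      rw [Real.exp_log (Real.sqrt_pos.2 hpos), Real.sq_sqrt hpos.le]
    refine ⟨circLine c (Real.log √(sqNorm a - 2 * c * a.re + c ^ 2)), isometry_circLine _ _,
      mem_range_circLine ?_, mem_range_circLine ?_, fun q hq => mem_range_circLine ?_⟩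
    · rw [hρ]; ring
    · rw [hρ]; linarith
    · rw [hρ]
      unfold Collinear3 at hq
      rw [← hc'] at hq
      have : sqNorm q - sqNorm a = 2 * c * (q.re - a.re) :=
        mul_left_cancel₀ hx' (by rw [hq]; ring)
      linarith

/-- The addition formula for cosh turns the equality into the vanishing of a polynomial in the three
values of cosh. Up to a nonzero factor, that polynomial is the square of the collinearity
determinant. -/
theorem collinear3_of_dist_add {a m q : ℍ} (h : dist a m + dist m q = dist a q) :
    Collinear3 a m q := by
  have hC := congrArg Real.cosh h
  rw [Real.cosh_add] at hC
  have hA := Real.sinh_sq (dist a m)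
  have hB := Real.sinh_sq (dist m q)
  have hG : (Real.cosh (dist a q) - Real.cosh (dist a m) * Real.cosh (dist m q)) ^ 2 =
      (Real.cosh (dist a m) ^ 2 - 1) * (Real.cosh (dist m q) ^ 2 - 1) := by
    rw [← hC, ← hA, ← hB]; ring
  rw [cosh_dist', cosh_dist', cosh_dist'] at hG
  have h1 := a.im_pos
  have h2 := m.im_pos
  have h3 := q.im_pos
  have key : ((m.re - a.re) * (sqNorm q - sqNorm a) - (q.re - a.re) * (sqNorm m - sqNorm a)) ^ 2
      = 0 := by
    rw [← sub_eq_zero] at hG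
    have hne : (4 * (a.im * m.im * q.im) ^ 2) ≠ 0 := by positivity
    rw [← mul_zero (-(4 * (a.im * m.im * q.im) ^ 2)), ← hG]
    unfold sqNorm
    field_simp
    ring
  exact sub_eq_zero.1 (pow_eq_zero_iff two_ne_zero |>.1 key)

theorem Collinear3.swap {a m q : ℍ} (h : Collinear3 a m q) : Collinear3 a q m := by
  unfold Collinear3 at *; linarith

theorem hasLines : HasLines ℍ := fun _ _ hab =>
  let ⟨c, hc, ha, hb, _⟩ := exists_line hab
  ⟨c, hc, ha, hb⟩

theorem uniqueBetween : UniqueBetween ℍ := by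
  intro a b m m' h h1 h2
  by_cases hab : a = b
  · subst hab
    have := dist_nonneg (x := a) (y := m)
    rw [dist_self, dist_comm m a] at h
    have h0 : dist a m = 0 := by linarith
    rw [← dist_eq_zero.1 h0, eq_comm, ← dist_eq_zero, h1, h0]
  obtain ⟨c, hc, ⟨s, rfl⟩, ⟨u, rfl⟩, hcol⟩ := exists_line hab
  obtain ⟨t, rfl⟩ := hcol m (collinear3_of_dist_add h).swap
  obtain ⟨t', rfl⟩ := hcol m' (collinear3_of_dist_add (by rw [h1, h2, h])).swap
  simp only [hc.dist_eq] at h h1 h2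
  exact congrArg c (uniqueBetween_real _ _ _ _ h h1 h2)

theorem nonBranching : NonBranching ℍ := by
  intro a m q q' ham h h1 h2
  obtain ⟨c, hc, ⟨s, rfl⟩, ⟨u, rfl⟩, hcol⟩ := exists_line ham
  obtain ⟨t, rfl⟩ := hcol q (collinear3_of_dist_add h)
  obtain ⟨t', rfl⟩ := hcol q' (collinear3_of_dist_add h1)
  simp only [hc.dist_eq] at h h1 h2
  exact congrArg c (nonBranching_real _ _ _ _ (fun e => ham (congrArg c e)) h h1 h2)

end UpperHalfPlane

/-! ### Geodesics of ℓ² products -/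

theorem minkowski_equality {p₁ p₂ q₁ q₂ r₁ r₂ : ℝ} (hp₁ : 0 ≤ p₁) (hp₂ : 0 ≤ p₂) (hq₁ : 0 ≤ q₁)
    (hq₂ : 0 ≤ q₂) (hr₁ : 0 ≤ r₁) (hr₂ : 0 ≤ r₂) (h₁ : r₁ ≤ p₁ + q₁) (h₂ : r₂ ≤ p₂ + q₂)
    (h : √(p₁ ^ 2 + p₂ ^ 2) + √(q₁ ^ 2 + q₂ ^ 2) = √(r₁ ^ 2 + r₂ ^ 2)) :
    (p₁ + q₁ = r₁ ∧ p₂ + q₂ = r₂) ∧ √(p₁ ^ 2 + p₂ ^ 2) * q₁ = √(q₁ ^ 2 + q₂ ^ 2) * p₁ ∧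
      √(p₁ ^ 2 + p₂ ^ 2) * q₂ = √(q₁ ^ 2 + q₂ ^ 2) * p₂ := by
  have hP := Real.sq_sqrt (show 0 ≤ p₁ ^ 2 + p₂ ^ 2 by positivity)
  have hQ := Real.sq_sqrt (show 0 ≤ q₁ ^ 2 + q₂ ^ 2 by positivity)
  have hR := Real.sq_sqrt (show 0 ≤ r₁ ^ 2 + r₂ ^ 2 by positivity)
  have hP0 := Real.sqrt_nonneg (p₁ ^ 2 + p₂ ^ 2)
  have hQ0 := Real.sqrt_nonneg (q₁ ^ 2 + q₂ ^ 2)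
  rw [← h] at hR
  generalize √(p₁ ^ 2 + p₂ ^ 2) = P at *
  generalize √(q₁ ^ 2 + q₂ ^ 2) = Q at *
  have s₁ : r₁ ^ 2 ≤ (p₁ + q₁) ^ 2 := pow_le_pow_left₀ hr₁ h₁ 2
  have s₂ : r₂ ^ 2 ≤ (p₂ + q₂) ^ 2 := pow_le_pow_left₀ hr₂ h₂ 2
  -- This is Cauchy–Schwarz reversed. Lagrange's identity then makes the vectors `p` and `q`
  -- parallel.
  have hle : P * Q ≤ p₁ * q₁ + p₂ * q₂ := by nlinarith
  have hlag : (P * Q) ^ 2 = (p₁ * q₁ + p₂ * q₂) ^ 2 + (p₁ * q₂ - p₂ * q₁) ^ 2 := by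
    rw [mul_pow, hP, hQ]; ring
  have hsq : (P * Q) ^ 2 ≤ (p₁ * q₁ + p₂ * q₂) ^ 2 := pow_le_pow_left₀ (by positivity) hle 2
  have hdet : p₁ * q₂ - p₂ * q₁ = 0 :=
    pow_eq_zero_iff two_ne_zero |>.1 (le_antisymm (by linarith) (sq_nonneg _))
  have hPQ : P * Q = p₁ * q₁ + p₂ * q₂ := by
    refine (pow_left_inj₀ (by positivity) (by positivity) two_ne_zero).1 ?_
    rw [hlag, hdet]; ring
  refine ⟨⟨?_, ?_⟩, ?_, ?_⟩
  · exact (pow_left_inj₀ (by positivity) hr₁ two_ne_zero).1 (by nlinarith)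
  · exact (pow_left_inj₀ (by positivity) hr₂ two_ne_zero).1 (by nlinarith)
  · rcases hP0.eq_or_lt with h0 | h0
    · subst h0
      have : p₁ = 0 := by nlinarith
      rw [this]; ring
    · refine mul_left_cancel₀ h0.ne' ?_
      linear_combination q₁ * hP - p₁ * hPQ - p₂ * hdet
  · rcases hP0.eq_or_lt with h0 | h0
    · subst h0
      have : p₂ = 0 := by nlinarith
      rw [this]; ring
    · refine mul_left_cancel₀ h0.ne' ?_
      linear_combination q₂ * hP - p₂ * hPQ + p₁ * hdet

section Curve

variable {X : Type*}

/-- The curve moving affinely along a line `ℓ` from `ℓ s` to `ℓ u` and in `ℝ` from `r` to `r'`. -/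
def productLine (ℓ : ℝ → X) (s u r r' k : ℝ) : WithLp 2 (X × ℝ) :=
  WithLp.toLp 2 (ℓ (param s u k), param r r' k)

theorem mem_range_productLine (ℓ : ℝ → X) {s u r r' : ℝ} (h : s ≠ u ∨ r ≠ r') (k : ℝ) :
    productLine ℓ s u r r' k ∈
      Set.range fun t => productLine ℓ s u r r' (t / √((u - s) ^ 2 + (r' - r) ^ 2)) := by
  have hpos : 0 < (u - s) ^ 2 + (r' - r) ^ 2 := by
    rcases h with h | h
    · have := sq_pos_of_ne_zero (sub_ne_zero.2 h.symm); positivity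
    · have := sq_pos_of_ne_zero (sub_ne_zero.2 h.symm); positivity
  have hD0 := Real.sqrt_pos.2 hpos
  exact ⟨k * √((u - s) ^ 2 + (r' - r) ^ 2), by simp only [mul_div_cancel_right₀ _ hD0.ne']⟩

@[simp] theorem productLine_zero (ℓ : ℝ → X) (s u r r' : ℝ) :
    productLine ℓ s u r r' 0 = WithLp.toLp 2 (ℓ s, r) := by simp [productLine, param]

@[simp] theorem productLine_one (ℓ : ℝ → X) (s u r r' : ℝ) :
    productLine ℓ s u r r' 1 = WithLp.toLp 2 (ℓ u, r') := by simp [productLine, param]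

end Curve

section Product

variable {X Y : Type*} [MetricSpace X] [MetricSpace Y]

theorem dist_withLp_two (p q : WithLp 2 (X × Y)) :
    dist p q = √(dist p.fst q.fst ^ 2 + dist p.snd q.snd ^ 2) := by
  rw [WithLp.prod_dist_eq_add (by norm_num), Real.sqrt_eq_rpow]
  norm_num

/-- Equality in Minkowski's inequality: betweenness passes to both factors, and each factor is
traversed in the same proportion. The proportions recover factor distances from distances in the
product. -/
theorem dist_add_withLp_two {a m b : WithLp 2 (X × Y)} (h : dist a m + dist m b = dist a b) :
    (dist a.fst m.fst + dist m.fst b.fst = dist a.fst b.fst ∧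
      dist a.snd m.snd + dist m.snd b.snd = dist a.snd b.snd) ∧
    dist a m * dist m.fst b.fst = dist m b * dist a.fst m.fst ∧
      dist a m * dist m.snd b.snd = dist m b * dist a.snd m.snd := by
  simp only [dist_withLp_two a m, dist_withLp_two m b, dist_withLp_two a b] at h ⊢
  exact minkowski_equality dist_nonneg dist_nonneg dist_nonneg dist_nonneg dist_nonneg dist_nonneg
    (dist_triangle _ _ _) (dist_triangle _ _ _) h

theorem withLp_two_ext {p q : WithLp 2 (X × Y)} (h₁ : p.fst = q.fst) (h₂ : p.snd = q.snd) :
    p = q := by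
  rw [← dist_eq_zero, dist_withLp_two, h₁, h₂]; simp

theorem UniqueBetween.withLp_two (hX : UniqueBetween X) (hY : UniqueBetween Y) :
    UniqueBetween (WithLp 2 (X × Y)) := by
  intro a b m m' h h1 h2
  obtain ⟨⟨e1, e2⟩, e3, e4⟩ := dist_add_withLp_two h
  obtain ⟨⟨f1, f2⟩, f3, f4⟩ := dist_add_withLp_two (show dist a m' + dist m' b = dist a b by
    rw [h1, h2, h])
  by_cases hab : dist a b = 0
  · have n1 := dist_nonneg (x := a) (y := m)
    have n2 := dist_nonneg (x := m) (y := b)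
    have z1 : dist a m = 0 := by linarith
    rw [← dist_eq_zero.1 z1, eq_comm, ← dist_eq_zero, h1, z1]
  rw [h1, h2] at f3 f4
  have k1 : dist a.fst m'.fst = dist a.fst m.fst := mul_left_cancel₀ hab (by
    rw [← h]; linear_combination e3 - f3 + dist a m * (f1 - e1))
  have k2 : dist a.snd m'.snd = dist a.snd m.snd := mul_left_cancel₀ hab (by
    rw [← h]; linear_combination e4 - f4 + dist a m * (f2 - e2))
  exact withLp_two_ext (hX _ _ _ _ e1 k1 (by linarith)) (hY _ _ _ _ e2 k2 (by linarith))

theorem NonBranching.withLp_two (hX : NonBranching X) (hY : NonBranching Y) :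
    NonBranching (WithLp 2 (X × Y)) := by
  intro a m q q' ham h h1 h2
  obtain ⟨⟨e1, e2⟩, e3, e4⟩ := dist_add_withLp_two h
  obtain ⟨⟨f1, f2⟩, f3, f4⟩ := dist_add_withLp_two h1
  have hne : dist a m ≠ 0 := dist_ne_zero.2 ham
  have k1 : dist m.fst q'.fst = dist m.fst q.fst := mul_left_cancel₀ hne (by rw [f3, e3, h2])
  have k2 : dist m.snd q'.snd = dist m.snd q.snd := mul_left_cancel₀ hne (by rw [f4, e4, h2])
  refine withLp_two_ext ?_ ?_
  -- A factor that stands still from `a` to `m` keeps standing still, by proportionality;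
  -- non-branching of the factor covers only the other case.
  · by_cases hc : a.fst = m.fst
    · rw [hc, dist_self, mul_zero] at e3
      have z := (mul_eq_zero.1 e3).resolve_left hne
      rw [z] at k1
      rw [← dist_eq_zero.1 z, ← dist_eq_zero.1 k1]
    · exact hX _ _ _ _ hc e1 f1 k1
  · by_cases hc : a.snd = m.snd
    · rw [hc, dist_self, mul_zero] at e4
      have z := (mul_eq_zero.1 e4).resolve_left hne
      rw [z] at k2
      rw [← dist_eq_zero.1 z, ← dist_eq_zero.1 k2]
    · exact hY _ _ _ _ hc e2 f2 k2

variable {ℓ : ℝ → X}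

theorem isometry_productLine (hℓ : Isometry ℓ) {s u r r' : ℝ} (h : s ≠ u ∨ r ≠ r') :
    Isometry fun t => productLine ℓ s u r r' (t / √((u - s) ^ 2 + (r' - r) ^ 2)) := by
  have hpos : 0 < (u - s) ^ 2 + (r' - r) ^ 2 := by
    rcases h with h | h
    · have := sq_pos_of_ne_zero (sub_ne_zero.2 h.symm); positivity
    · have := sq_pos_of_ne_zero (sub_ne_zero.2 h.symm); positivity
  refine Isometry.of_dist_eq fun x y => ?_
  have hD := Real.sq_sqrt hpos.le
  have hD0 := Real.sqrt_pos.2 hpos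
  set D := √((u - s) ^ 2 + (r' - r) ^ 2)
  rw [dist_withLp_two]
  change √(dist (ℓ (param s u (x / D))) (ℓ (param s u (y / D))) ^ 2 +
    dist (param r r' (x / D)) (param r r' (y / D)) ^ 2) = _
  simp only [hℓ.dist_eq, param, Real.dist_eq, sq_abs]
  rw [← Real.sqrt_sq_eq_abs (x - y)]
  congr 1
  field_simp
  rw [hD]
  ring

theorem isGeodesic_productLine (hℓ : Isometry ℓ) {s u r r' : ℝ} (h : s ≠ u ∨ r ≠ r') :
    IsGeodesic (Set.range (productLine ℓ s u r r')) := by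
  have := (isometry_productLine hℓ h).isGeodesic_range
  convert this using 1
  refine Set.Subset.antisymm ?_ ?_
  · rintro _ ⟨k, rfl⟩
    exact mem_range_productLine ℓ h k
  · rintro _ ⟨k, rfl⟩
    exact ⟨_, rfl⟩

theorem ClosedUnderLines.productLine_mem {S : Set (WithLp 2 (X × ℝ))} (hS : ClosedUnderLines S)
    (hℓ : Isometry ℓ) {s u r r' : ℝ} (h : s ≠ u ∨ r ≠ r') (h0 : WithLp.toLp 2 (ℓ s, r) ∈ S)
    (h1 : WithLp.toLp 2 (ℓ u, r') ∈ S) (k : ℝ) : productLine ℓ s u r r' k ∈ S := by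
  have hi := isometry_productLine hℓ h
  obtain ⟨t0, e0⟩ := mem_range_productLine ℓ h 0
  obtain ⟨t1, e1⟩ := mem_range_productLine ℓ h 1
  obtain ⟨t, e⟩ := mem_range_productLine ℓ h k
  rw [productLine_zero] at e0
  rw [productLine_one] at e1
  rw [← e]
  refine hS _ hi t0 t1 ?_ ?_ ?_ t
  · rintro rfl
    rw [e0, WithLp.toLp.injEq, Prod.mk.injEq] at e1
    rcases h with h | h
    · exact h (hℓ.injective e1.1)
    · exact h e1.2
  · rw [← e0] at h0; exact h0
  · rw [← e1] at h1; exact h1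

end Product

namespace UpperHalfPlane

theorem exists_isometry_through (x y : ℍ) :
    ∃ ℓ : ℝ → ℍ, Isometry ℓ ∧ ∃ s u, ℓ s = x ∧ ℓ u = y := by
  by_cases h : x = y
  · obtain ⟨s, hs⟩ := mem_range_vertLine (rfl : x.re = x.re)
    exact ⟨_, isometry_vertLine _, s, s, hs, h ▸ hs⟩
  · obtain ⟨ℓ, hℓ, ⟨s, hs⟩, ⟨u, hu⟩⟩ := hasLines x y h
    exact ⟨ℓ, hℓ, s, u, hs, hu⟩

end UpperHalfPlane

namespace HypTimesReal

theorem uniqueBetween : UniqueBetween HypTimesReal :=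
  UpperHalfPlane.uniqueBetween.withLp_two uniqueBetween_real

theorem nonBranching : NonBranching HypTimesReal :=
  UpperHalfPlane.nonBranching.withLp_two nonBranching_real

theorem exists_productLine {p q : HypTimesReal} (hpq : p ≠ q) :
    ∃ (ℓ : ℝ → ℍ) (s u : ℝ), Isometry ℓ ∧ (s ≠ u ∨ p.snd ≠ q.snd) ∧
      WithLp.toLp 2 (ℓ s, p.snd) = p ∧ WithLp.toLp 2 (ℓ u, q.snd) = q := by
  obtain ⟨ℓ, hℓ, s, u, hs, hu⟩ := UpperHalfPlane.exists_isometry_through p.fst q.fst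
  refine ⟨ℓ, s, u, hℓ, ?_, withLp_two_ext hs rfl, withLp_two_ext hu rfl⟩
  by_contra hcon
  push Not at hcon
  exact hpq (withLp_two_ext (by rw [← hs, ← hu, hcon.1]) hcon.2)

theorem hasLines : HasLines HypTimesReal := by
  intro p q hpq
  obtain ⟨ℓ, s, u, hℓ, h, hp, hq⟩ := exists_productLine hpq
  refine ⟨_, isometry_productLine hℓ h, ?_, ?_⟩
  · have := mem_range_productLine ℓ h 0
    rwa [productLine_zero, hp] at this
  · have := mem_range_productLine ℓ h 1
    rwa [productLine_one, hq] at this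

end HypTimesReal

/-! ### Line-closed subsets and affine functions of the hyperbolic plane -/

namespace UpperHalfPlane

theorem exists_re_sqNorm {x r : ℝ} (h : x ^ 2 < r) : ∃ z : ℍ, z.re = x ∧ sqNorm z = r := by
  have h' : 0 < r - x ^ 2 := sub_pos.2 h
  refine ⟨⟨⟨x, √(r - x ^ 2)⟩, Real.sqrt_pos.2 h'⟩, rfl, ?_⟩
  simp [sqNorm, Real.sq_sqrt h'.le]

theorem re_sq_lt_sqNorm (z : ℍ) : z.re ^ 2 < sqNorm z := by
  have := z.im_pos
  unfold sqNorm
  nlinarith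

theorem _root_.ClosedUnderLines.mem_of_collinear3 {T : Set ℍ} (hT : ClosedUnderLines T) {a b w : ℍ}
    (ha : a ∈ T) (hb : b ∈ T) (hab : a ≠ b) (h : Collinear3 a b w) : w ∈ T := by
  obtain ⟨c, hc, ⟨s, rfl⟩, ⟨u, rfl⟩, hcol⟩ := exists_line hab
  obtain ⟨t, rfl⟩ := hcol w h
  exact hT c hc s u (fun e => hab (congrArg c e)) ha hb t

-- In the linear coordinates, let `w = a + β(b - a) + γ(q - a)`. The points `b' = a + (β/K)(b - a)`
-- and `q' = a - (γ/(K-1))(q - a)` satisfy `w = K b' + (1 - K) q'`. For large `K` both are close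
-- enough to `a` to lie above the parabola, so they are in `T`, and then so is `w`.
open Filter Topology in
theorem _root_.ClosedUnderLines.eq_univ {T : Set ℍ} (hT : ClosedUnderLines T) {a b q : ℍ}
    (ha : a ∈ T) (hb : b ∈ T) (hq : q ∈ T) (h : ¬ Collinear3 a b q) : T = Set.univ := by
  refine Set.eq_univ_of_forall fun w => ?_
  set A := b.re - a.re with hA
  set B := sqNorm b - sqNorm a with hB
  set C := q.re - a.re with hC
  set E := sqNorm q - sqNorm a with hE
  have hD : A * E - C * B ≠ 0 := sub_ne_zero.2 h
  have hab : a ≠ b := by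
    rintro rfl
    apply hD
    rw [hA, hB]; ring
  have haq : a ≠ q := by
    rintro rfl
    apply hD
    rw [hC, hE]; ring
  set β := ((w.re - a.re) * E - C * (sqNorm w - sqNorm a)) / (A * E - C * B) with hβ
  set γ := (A * (sqNorm w - sqNorm a) - (w.re - a.re) * B) / (A * E - C * B) with hγ
  have hw1 : w.re - a.re = β * A + γ * C := by
    rw [hβ, hγ, div_mul_eq_mul_div, div_mul_eq_mul_div, ← add_div, eq_div_iff hD]; ring
  have hw2 : sqNorm w - sqNorm a = β * B + γ * E := by
    rw [hβ, hγ, div_mul_eq_mul_div, div_mul_eq_mul_div, ← add_div, eq_div_iff hD]; ring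
  by_cases hβ0 : β = 0
  · refine hT.mem_of_collinear3 ha hq haq ?_
    unfold Collinear3
    rw [hw1, hw2, hβ0, ← hC, ← hE]; ring
  by_cases hγ0 : γ = 0
  · refine hT.mem_of_collinear3 ha hb hab ?_
    unfold Collinear3
    rw [hw1, hw2, hγ0, ← hA, ← hB]; ring
  have near : ∀ (v₁ v₂ : ℝ) (g : ℝ → ℝ), Tendsto g atTop (𝓝 0) →
      ∀ᶠ K in atTop, (a.re + g K * v₁) ^ 2 < sqNorm a + g K * v₂ := by
    intro v₁ v₂ g hg
    have t1 : Tendsto (fun K => (a.re + g K * v₁) ^ 2) atTop (𝓝 ((a.re + 0 * v₁) ^ 2)) :=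
      (tendsto_const_nhds.add (hg.mul tendsto_const_nhds)).pow 2
    have t2 : Tendsto (fun K => sqNorm a + g K * v₂) atTop (𝓝 (sqNorm a + 0 * v₂)) :=
      tendsto_const_nhds.add (hg.mul tendsto_const_nhds)
    refine t1.eventually_lt t2 ?_
    simpa using re_sq_lt_sqNorm a
  have l1 : Tendsto (fun K : ℝ => β / K) atTop (𝓝 0) := tendsto_const_nhds.div_atTop tendsto_id
  have l2 : Tendsto (fun K : ℝ => -(γ / (K - 1))) atTop (𝓝 0) := by
    simpa [sub_eq_add_neg] using (tendsto_const_nhds.div_atTop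
      (tendsto_atTop_add_const_right atTop (-1 : ℝ) tendsto_id) : Tendsto
        (fun K : ℝ => γ / (id K + -1)) atTop (𝓝 0)).neg
  obtain ⟨K, h1, h2, hK⟩ := ((near A B _ l1).and ((near C E _ l2).and
    (eventually_gt_atTop (1 : ℝ)))).exists
  have hK0 : K ≠ 0 := by linarith
  have hK1 : K - 1 ≠ 0 := by linarith
  obtain ⟨b', hb1, hb2⟩ := exists_re_sqNorm h1
  obtain ⟨q', hq1, hq2⟩ := exists_re_sqNorm h2
  have hb' : b' ∈ T := hT.mem_of_collinear3 ha hb hab (by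
    unfold Collinear3; rw [hb1, hb2, ← hA, ← hB]; ring)
  have hq' : q' ∈ T := hT.mem_of_collinear3 ha hq haq (by
    unfold Collinear3; rw [hq1, hq2, ← hC, ← hE]; ring)
  refine hT.mem_of_collinear3 hb' hq' ?_ ?_
  · intro e
    rw [e, hq1] at hb1
    rw [e, hq2] at hb2
    have e1 : -(γ / (K - 1)) * C = β / K * A := by linarith
    have e2 : -(γ / (K - 1)) * E = β / K * B := by linarith
    have : β / K * (A * E - C * B) = 0 := by linear_combination C * e2 - E * e1
    rcases mul_eq_zero.1 this with h0 | h0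
    · exact div_ne_zero hβ0 hK0 h0
    · exact hD h0
  · unfold Collinear3
    rw [show w.re = a.re + (β * A + γ * C) by linarith,
      show sqNorm w = sqNorm a + (β * B + γ * E) by linarith, hb1, hb2, hq1, hq2]
    field_simp
    ring

theorem _root_.ClosedUnderLines.trichotomy {T : Set ℍ} (hT : ClosedUnderLines T) :
    T.Subsingleton ∨ (∃ c : ℝ → ℍ, Isometry c ∧ T = Set.range c) ∨ T = Set.univ := by
  by_cases h : T.Subsingleton
  · exact Or.inl h
  rw [Set.not_subsingleton_iff] at h
  obtain ⟨a, ha, b, hb, hab⟩ := h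
  by_cases hq : ∀ q ∈ T, Collinear3 a b q
  · obtain ⟨c, hc, ⟨s, rfl⟩, ⟨u, rfl⟩, hcol⟩ := exists_line hab
    refine Or.inr (Or.inl ⟨c, hc, Set.Subset.antisymm (fun q h => hcol q (hq q h)) ?_⟩)
    rintro _ ⟨t, rfl⟩
    exact hT c hc s u (fun e => hab (congrArg c e)) ha hb t
  · push Not at hq
    obtain ⟨q, hqT, hq⟩ := hq
    exact Or.inr (Or.inr (hT.eq_univ ha hb hqT hq))

/-- The real part along a half circle is not affine in arc length; this gap is what makes affine
functions constant. -/
theorem tanh_two_half_lt : Real.tanh 2 / 2 < Real.tanh 1 := by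
  have hs : 0 < Real.sinh 1 := Real.sinh_pos_iff.2 one_pos
  have hc := Real.cosh_pos 1
  rw [show (2 : ℝ) = 2 * 1 by norm_num, Real.tanh_eq_sinh_div_cosh, Real.tanh_eq_sinh_div_cosh,
    Real.sinh_two_mul, Real.cosh_two_mul, mul_one, div_div, div_lt_div_iff₀ (by positivity) hc]
  have : 0 < Real.sinh 1 ^ 3 := by positivity
  nlinarith

/-- A function on the hyperbolic plane which is affine along every line is constant. -/
theorem eq_of_affine_on_lines {f : ℍ → ℝ}
    (hf : ∀ ℓ : ℝ → ℍ, Isometry ℓ → ∀ s u k, f (ℓ (param s u k)) = param (f (ℓ s)) (f (ℓ u)) k)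
    (z w : ℍ) : f z = f w := by
  obtain ⟨a, b, hab⟩ : ∃ a b : ℝ → ℝ, ∀ z : ℍ, f z = a z.re + b z.re * Real.log z.im := by
    refine ⟨fun x => f (vertLine x 0), fun x => f (vertLine x 1) - f (vertLine x 0), fun z => ?_⟩
    have := hf _ (isometry_vertLine z.re) 0 1 (Real.log z.im)
    have e : vertLine z.re (param 0 1 (Real.log z.im)) = z :=
      ext_re_im rfl (by simp [param, Real.exp_log z.im_pos])
    rw [e] at this
    rw [this, param]; ring
  -- The hyperbolic midpoint of `(c - h, y)` and `(c + h, y)` is `(c, √(h² + y²))`.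
  have mid : ∀ c h y : ℝ, 0 < y → a (c - h) + a (c + h) + (b (c - h) + b (c + h)) * Real.log y =
      2 * a c + b c * Real.log (h ^ 2 + y ^ 2) := by
    intro c h y hy
    have hpos : 0 < h ^ 2 + y ^ 2 := by positivity
    set ρ := Real.log √(h ^ 2 + y ^ 2) with hρ
    have hexp : Real.exp ρ ^ 2 = h ^ 2 + y ^ 2 := by
      rw [hρ, Real.exp_log (Real.sqrt_pos.2 hpos), Real.sq_sqrt hpos.le]
    have hc : Real.cosh (Real.arsinh (h / y)) = Real.exp ρ / y := by
      rw [Real.cosh_arsinh, Real.sqrt_eq_iff_mul_self_eq (by positivity) (by positivity)]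
      field_simp
      linarith
    have he := Real.exp_pos ρ
    have ht : Real.exp ρ * Real.tanh (Real.arsinh (h / y)) = h := by
      rw [Real.tanh_eq_sinh_div_cosh, hc, Real.sinh_arsinh]
      field_simp
    have hi : Real.exp ρ / Real.cosh (Real.arsinh (h / y)) = y := by
      rw [hc]
      field_simp
    have := hf _ (isometry_circLine c ρ) (-Real.arsinh (h / y)) (Real.arsinh (h / y)) (1 / 2)
    rw [show param (-Real.arsinh (h / y)) (Real.arsinh (h / y)) (1 / 2) = 0 by
      unfold param; ring, hab, hab, hab] at this
    simp only [circLine_re, circLine_im, Real.tanh_neg, Real.cosh_neg, mul_neg, ht, hi,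
      Real.tanh_zero, Real.cosh_zero, mul_zero, add_zero, div_one, Real.log_exp, param] at this
    rw [← hexp, Real.log_pow, Real.log_exp, ← sub_eq_add_neg] at *
    push_cast
    linarith
  have hb : ∀ c, b c = 0 := by
    intro c
    -- The left side is affine in `log y`, so its values at `log y = 0, ±(log 3)/2` are in
    -- arithmetic progression; those of `log (1 + y²)` are not.
    have h1 := mid c 1 1 one_pos
    have h2 := mid c 1 (√3) (by positivity)
    have h3 := mid c 1 (√3)⁻¹ (by positivity)
    rw [Real.log_inv, inv_pow, Real.sq_sqrt (by norm_num),
      show (1 ^ 2 + 3⁻¹ : ℝ) = 2 ^ 2 / 3 by norm_num, Real.log_div (by norm_num) (by norm_num),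
      Real.log_pow] at h3
    rw [Real.sq_sqrt (by norm_num), show (1 ^ 2 + 3 : ℝ) = 2 ^ 2 by norm_num, Real.log_pow] at h2
    rw [Real.log_one, show (1 ^ 2 + 1 ^ 2 : ℝ) = 2 by norm_num] at h1
    push_cast at h2 h3
    have hlt : Real.log 3 < 2 * Real.log 2 := by
      have := Real.log_lt_log (by norm_num) (show (3 : ℝ) < 2 ^ 2 by norm_num)
      rwa [Real.log_pow] at this
    have : b c * (2 * Real.log 2 - Real.log 3) = 0 := by linarith
    exact (mul_eq_zero.1 this).resolve_right (by linarith)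
  simp only [hb, zero_mul, add_zero] at hab mid
  have hlt : ∀ x x', x < x' → a x = a x' := by
    intro x x' hx
    have hδ := sub_pos.2 tanh_two_half_lt
    set δ := Real.tanh 1 - Real.tanh 2 / 2 with hδ'
    have hr : 0 < (x' - x) / δ := div_pos (sub_pos.2 hx) hδ
    set r := (x' - x) / δ with hrd
    have hrδ : r * δ = x' - x := by rw [hrd]; field_simp
    -- On the half circle with centre `c` and radius `r`, the values of `a` at parameters 0 and 2
    -- average to `a x'` (parameter 1). By `mid` they also average to `a` at the Euclidean midpoint
    -- of their real parts, which is `x`. The radius makes the gap `r * δ` equal to `x' - x`.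
    set c := x - r * (Real.tanh 2 / 2) with hcd
    have e1 := hf _ (isometry_circLine c (Real.log r)) 0 2 (1 / 2)
    rw [show param 0 2 (1 / 2) = 1 by unfold param; norm_num, hab, hab, hab] at e1
    simp only [circLine_re, Real.exp_log hr, Real.tanh_zero, mul_zero, add_zero, param] at e1
    have e2 := mid x (r * (Real.tanh 2 / 2)) 1 one_pos
    rw [← hcd, show x + r * (Real.tanh 2 / 2) = c + r * Real.tanh 2 by rw [hcd]; ring] at e2
    rw [show c + r * Real.tanh 1 = x' by rw [hcd]; linarith] at e1
    linarith
  rw [hab, hab]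
  rcases lt_trichotomy z.re w.re with h | h | h
  · exact hlt _ _ h
  · rw [h]
  · exact (hlt _ _ h).symm

end UpperHalfPlane

/-! ### Classification of line-closed subsets of the product -/

theorem exists_param_eq {s u : ℝ} (h : s ≠ u) (t : ℝ) : ∃ k, param s u k = t := by
  have : u - s ≠ 0 := sub_ne_zero.2 h.symm
  exact ⟨(t - s) / (u - s), by unfold param; field_simp; ring⟩

namespace HypTimesReal

/-- The projection of a subset of `ℍ × ℝ` to `ℍ`. -/
def shadow (S : Set HypTimesReal) : Set ℍ := {x | ∃ r : ℝ, WithLp.toLp 2 (x, r) ∈ S}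

variable {S : Set HypTimesReal}

theorem closedUnderLines_shadow (hS : ClosedUnderLines S) : ClosedUnderLines (shadow S) := by
  rintro ℓ hℓ s u hsu ⟨r, hr⟩ ⟨r', hr'⟩ t
  obtain ⟨k, rfl⟩ := exists_param_eq hsu t
  exact ⟨_, hS.productLine_mem hℓ (Or.inl hsu) hr hr' k⟩

theorem fibre_full (hS : ClosedUnderLines S) {x y : ℍ} {r₁ r₂ r : ℝ} (hr : r₁ ≠ r₂)
    (h₁ : WithLp.toLp 2 (x, r₁) ∈ S) (h₂ : WithLp.toLp 2 (x, r₂) ∈ S)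
    (h : WithLp.toLp 2 (y, r) ∈ S) (t : ℝ) : WithLp.toLp 2 (y, t) ∈ S := by
  obtain ⟨ℓ, hℓ, s, u, rfl, rfl⟩ := UpperHalfPlane.exists_isometry_through x y
  have hx : ∀ t, WithLp.toLp 2 (ℓ s, t) ∈ S := by
    intro t
    obtain ⟨k, rfl⟩ := exists_param_eq hr t
    have := hS.productLine_mem hℓ (Or.inr hr) h₁ h₂ k
    rwa [productLine, show param s s k = s by simp [param]] at this
  by_cases hsu : s = u
  · exact hsu ▸ hx t
  -- Let `z` be the reflection of `x` in `y`. The line from `(x, 2r - v)` through `(y, r)` reaches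
  -- height `v` over `z`, so the fibre over `z` is full; midpoints of `(x, t)` and `(z, t)` then
  -- fill the fibre over `y`.
  have hz : ∀ v, WithLp.toLp 2 (ℓ (param s u 2), v) ∈ S := by
    intro v
    have := hS.productLine_mem hℓ (Or.inl hsu) (hx (2 * r - v)) h 2
    rwa [productLine, show param (2 * r - v) r 2 = v by unfold param; ring] at this
  have hne : s ≠ param s u 2 := by
    intro e
    apply hsu
    unfold param at e
    linarith
  have := hS.productLine_mem hℓ (Or.inl hne) (hx t) (hz t) (1 / 2)
  rwa [productLine, show param t t (1 / 2) = t by simp [param],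
    show param s (param s u 2) (1 / 2) = u by unfold param; ring] at this

theorem isVerticalPlane_of_fibre (hS : ClosedUnderLines S) (hnt : ¬ IsTrivialSubset S) {x : ℍ}
    {r₁ r₂ : ℝ} (hr : r₁ ≠ r₂) (h₁ : WithLp.toLp 2 (x, r₁) ∈ S)
    (h₂ : WithLp.toLp 2 (x, r₂) ∈ S) : IsVerticalPlane S := by
  have hSv : S = verticalOver (shadow S) := by
    ext ⟨y, t⟩
    exact ⟨fun h => ⟨t, h⟩, fun ⟨_, h⟩ => fibre_full hS hr h₁ h₂ h t⟩
  rcases (closedUnderLines_shadow hS).trichotomy with h | ⟨c, hc, h⟩ | h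
  · refine absurd (Or.inl ?_) hnt
    obtain ⟨ℓ, hℓ, s, -, hs, -⟩ := UpperHalfPlane.exists_isometry_through x x
    have : S = Set.range (productLine ℓ s s 0 1) := by
      ext ⟨y, t⟩
      constructor
      · intro hy
        have hyx : y = x := h ⟨t, hy⟩ ⟨r₁, h₁⟩
        exact ⟨t, by simp [productLine, param, hs, hyx]⟩
      · rintro ⟨k, hk⟩
        rw [← hk, hSv]
        exact ⟨r₁, by simpa [productLine, param, hs] using h₁⟩
    rw [this]
    exact isGeodesic_productLine hℓ (Or.inr zero_ne_one)
  · exact ⟨_, hc.isGeodesic_range, h ▸ hSv⟩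
  · refine absurd (Or.inr ?_) hnt
    rw [hSv, h]
    rfl

theorem isHorizontalPlane_of_graph (hTG : IsTotallyGeodesic S) (hS : ClosedUnderLines S)
    (hnt : ¬ IsTrivialSubset S)
    (hgr : ∀ x r r', WithLp.toLp 2 (x, r) ∈ S → WithLp.toLp 2 (x, r') ∈ S → r = r') :
    IsHorizontalPlane S := by
  rcases (closedUnderLines_shadow hS).trichotomy with h | ⟨c, hc, h⟩ | h
  · exfalso
    obtain ⟨p, hp⟩ := hTG.1
    -- The case of equal points in the definition excludes singletons, which are closed under lines.
    obtain ⟨G, ⟨c, hc, rfl⟩, -, -, hG⟩ := hTG.2 p hp p hp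
    have hc := hc.isometry uniqueBetween nonBranching hasLines
    have h0 : c 0 ∈ S := hG ⟨0, rfl⟩
    have h1 : c 1 ∈ S := hG ⟨1, rfl⟩
    have e : (c 0).fst = (c 1).fst := h ⟨(c 0).snd, h0⟩ ⟨(c 1).snd, h1⟩
    have e' : (c 0).snd = (c 1).snd := hgr (c 0).fst _ _ h0 (e ▸ h1)
    exact zero_ne_one (hc.injective (withLp_two_ext e e'))
  · refine absurd (Or.inl ?_) hnt
    obtain ⟨r, hr⟩ : c 0 ∈ shadow S := h ▸ ⟨0, rfl⟩
    obtain ⟨r', hr'⟩ : c 1 ∈ shadow S := h ▸ ⟨1, rfl⟩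
    have hmem := hS.productLine_mem hc (Or.inl zero_ne_one) hr hr'
    have : S = Set.range (productLine c 0 1 r r') := by
      refine Set.Subset.antisymm ?_ (Set.range_subset_iff.2 hmem)
      rintro ⟨y, t⟩ hy
      obtain ⟨k, rfl⟩ : y ∈ Set.range c := h ▸ ⟨t, hy⟩
      have hk := hmem k
      rw [productLine, show param 0 1 k = k by simp [param]] at hk
      refine ⟨k, ?_⟩
      rw [productLine, show param 0 1 k = k by simp [param], hgr _ _ _ hk hy]
    rw [this]
    exact isGeodesic_productLine hc (Or.inl zero_ne_one)
  · have hall : ∀ x : ℍ, ∃ r : ℝ, WithLp.toLp 2 (x, r) ∈ S := fun x =>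
      (h ▸ Set.mem_univ x : x ∈ shadow S)
    choose f hf using hall
    have hconst := UpperHalfPlane.eq_of_affine_on_lines (f := f) (by
      intro ℓ hℓ s u k
      by_cases hsu : s = u
      · subst hsu
        simp [param]
      · exact hgr _ _ _ (hf _) (hS.productLine_mem hℓ (Or.inl hsu) (hf _) (hf _) k))
    refine ⟨f UpperHalfPlane.I, ?_⟩
    ext ⟨x, t⟩
    constructor
    · intro hx
      exact (hgr x t (f x) hx (hf x)).trans (hconst _ _)
    · intro hx
      have ht : t = f x := (show t = f UpperHalfPlane.I from hx).trans (hconst _ _)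
      rw [ht]
      exact hf x

/-! ### The planes are totally geodesic and nontrivial -/

theorem isTotallyGeodesic_horizontalPlane (r : ℝ) : IsTotallyGeodesic (horizontalPlane r) := by
  refine ⟨⟨WithLp.toLp 2 (UpperHalfPlane.I, r), rfl⟩, ?_⟩
  have key : ∀ (ℓ : ℝ → ℍ) (s u : ℝ), Isometry ℓ → s ≠ u →
      ∃ G : Set HypTimesReal, IsGeodesic G ∧ WithLp.toLp 2 (ℓ s, r) ∈ G ∧
        WithLp.toLp 2 (ℓ u, r) ∈ G ∧ G ⊆ horizontalPlane r := by
    intro ℓ s u hℓ hsu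
    refine ⟨_, isGeodesic_productLine hℓ (r := r) (r' := r) (Or.inl hsu),
      ⟨0, productLine_zero _ _ _ _ _⟩, ⟨1, productLine_one _ _ _ _ _⟩, ?_⟩
    rintro _ ⟨k, rfl⟩
    show param r r k = r
    simp [param]
  rintro ⟨x, t⟩ hp ⟨y, t'⟩ hq
  obtain rfl : t = r := hp
  obtain rfl : t' = t := hq
  obtain ⟨ℓ, hℓ, s, u, rfl, rfl⟩ := UpperHalfPlane.exists_isometry_through x y
  by_cases hsu : s = u
  · obtain ⟨G, hG, h0, -, hsub⟩ := key ℓ s (s + 1) hℓ (by simp)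
    exact ⟨G, hG, h0, hsu ▸ h0, hsub⟩
  · exact key ℓ s u hℓ hsu

theorem isTotallyGeodesic_verticalOver {γ : Set ℍ} (hγ : IsGeodesic γ) :
    IsTotallyGeodesic (verticalOver γ) := by
  obtain ⟨c, hc, rfl⟩ := hγ
  have hc := hc.isometry UpperHalfPlane.uniqueBetween UpperHalfPlane.nonBranching
    UpperHalfPlane.hasLines
  refine ⟨⟨WithLp.toLp 2 (c 0, 0), ⟨0, rfl⟩⟩, ?_⟩
  have key : ∀ s u r r' : ℝ, s ≠ u ∨ r ≠ r' →
      ∃ G : Set HypTimesReal, IsGeodesic G ∧ WithLp.toLp 2 (c s, r) ∈ G ∧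
        WithLp.toLp 2 (c u, r') ∈ G ∧ G ⊆ verticalOver (Set.range c) := by
    intro s u r r' h
    refine ⟨_, isGeodesic_productLine hc h,
      ⟨0, productLine_zero _ _ _ _ _⟩, ⟨1, productLine_one _ _ _ _ _⟩, ?_⟩
    rintro _ ⟨k, rfl⟩
    exact ⟨_, rfl⟩
  rintro ⟨_, t⟩ ⟨s, rfl⟩ ⟨_, t'⟩ ⟨u, rfl⟩
  by_cases h : s ≠ u ∨ t ≠ t'
  · exact key s u t t' h
  · push Not at h
    obtain ⟨rfl, rfl⟩ := h
    obtain ⟨G, hG, h0, -, hsub⟩ := key s s t (t + 1) (Or.inr (by simp))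
    exact ⟨G, hG, h0, h0, hsub⟩

end HypTimesReal

namespace UpperHalfPlane

/-- There are three distinct points at the same distance from `I`. -/
theorem exists_three_equidistant : ∃ p q r : ℍ, p ≠ q ∧ q ≠ r ∧ p ≠ r ∧
    dist I p = dist I q ∧ dist I p = dist I r := by
  -- The circle `cosh d = 3/2` about `I` passes through `1 + i`, `-1 + i` and `1 + 2i`.
  have hd : ∀ z : ℍ, z.re ^ 2 + 1 + z.im ^ 2 = 3 * z.im → Real.cosh (dist I z) = 3 / 2 := by
    intro z hz
    have := z.im_pos
    rw [cosh_dist', I_re, I_im, div_eq_div_iff (by positivity) (by norm_num)]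
    linarith
  have inj : ∀ z w : ℍ, Real.cosh (dist I z) = 3 / 2 → Real.cosh (dist I w) = 3 / 2 →
      dist I z = dist I w := by
    intro z w hz hw
    rw [← abs_of_nonneg (dist_nonneg (x := I) (y := z)),
      ← abs_of_nonneg (dist_nonneg (x := I) (y := w))]
    exact le_antisymm (Real.cosh_le_cosh.1 (by rw [hz, hw])) (Real.cosh_le_cosh.1 (by rw [hz, hw]))
  have h1 := hd ⟨⟨1, 1⟩, one_pos⟩ (by simp; norm_num)
  have h2 := hd ⟨⟨-1, 1⟩, one_pos⟩ (by simp; norm_num)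
  have h3 := hd ⟨⟨1, 2⟩, two_pos⟩ (by simp; norm_num)
  refine ⟨⟨⟨1, 1⟩, one_pos⟩, ⟨⟨-1, 1⟩, one_pos⟩, ⟨⟨1, 2⟩, two_pos⟩, ?_, ?_, ?_, inj _ _ h1 h2,
    inj _ _ h1 h3⟩
  · intro e
    have := congrArg re e
    norm_num at this
  · intro e
    have := congrArg re e
    norm_num at this
  · intro e
    have := congrArg im e
    norm_num at this

theorem not_isGeodesic_univ : ¬ IsGeodesic (Set.univ : Set ℍ) := by
  intro h
  obtain ⟨p, q, r, hpq, hqr, hpr, h1, h2⟩ := exists_three_equidistant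
  exact h.not_three_equidistant uniqueBetween nonBranching hasLines (o := I) trivial trivial trivial
    trivial hpq hqr hpr h1 h2

end UpperHalfPlane

namespace HypTimesReal

theorem dist_toLp (x y : ℍ) (r t : ℝ) :
    dist (WithLp.toLp 2 (x, r) : HypTimesReal) (WithLp.toLp 2 (y, t)) =
      √(dist x y ^ 2 + dist r t ^ 2) :=
  dist_withLp_two _ _

theorem not_isTrivialSubset_horizontalPlane (r : ℝ) : ¬ IsTrivialSubset (horizontalPlane r) := by
  rintro (h | h)
  · obtain ⟨a, b, c, hab, hbc, hac, h1, h2⟩ := UpperHalfPlane.exists_three_equidistant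
    refine h.not_three_equidistant uniqueBetween nonBranching hasLines
      (o := WithLp.toLp 2 (UpperHalfPlane.I, r)) (p := WithLp.toLp 2 (a, r))
      (q := WithLp.toLp 2 (b, r)) (r := WithLp.toLp 2 (c, r)) rfl rfl rfl rfl ?_ ?_ ?_ ?_ ?_
    · exact fun e => hab (congrArg (fun z : HypTimesReal => z.fst) e)
    · exact fun e => hbc (congrArg (fun z : HypTimesReal => z.fst) e)
    · exact fun e => hac (congrArg (fun z : HypTimesReal => z.fst) e)
    · rw [dist_toLp, dist_toLp, h1]
    · rw [dist_toLp, dist_toLp, h2]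
  · have : (WithLp.toLp 2 (UpperHalfPlane.I, r + 1) : HypTimesReal) ∈ horizontalPlane r :=
      h ▸ Set.mem_univ _
    have : r + 1 = r := this
    linarith

theorem not_isTrivialSubset_verticalOver {γ : Set ℍ} (hγ : IsGeodesic γ) :
    ¬ IsTrivialSubset (verticalOver γ) := by
  rintro (h | h)
  · obtain ⟨c, hc, rfl⟩ := hγ
    have hc := hc.isometry UpperHalfPlane.uniqueBetween UpperHalfPlane.nonBranching
      UpperHalfPlane.hasLines
    -- Three points at distance 1 from `(c 0, 0)`: two above and below it, one sideways along `c`.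
    refine h.not_three_equidistant uniqueBetween nonBranching hasLines
      (o := WithLp.toLp 2 (c 0, 0)) (p := WithLp.toLp 2 (c 0, 1))
      (q := WithLp.toLp 2 (c 0, -1)) (r := WithLp.toLp 2 (c 1, 0)) ⟨0, rfl⟩ ⟨0, rfl⟩ ⟨0, rfl⟩
      ⟨1, rfl⟩ ?_ ?_ ?_ ?_ ?_
    · intro e
      have : (1 : ℝ) = -1 := congrArg (fun z : HypTimesReal => z.snd) e
      linarith
    · intro e
      have : (-1 : ℝ) = 0 := congrArg (fun z : HypTimesReal => z.snd) e
      linarith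
    · intro e
      have : (1 : ℝ) = 0 := congrArg (fun z : HypTimesReal => z.snd) e
      linarith
    · rw [dist_toLp, dist_toLp]; simp
    · rw [dist_toLp, dist_toLp, hc.dist_eq, hc.dist_eq]; simp
  · refine UpperHalfPlane.not_isGeodesic_univ ?_
    have : γ = Set.univ := Set.eq_univ_of_forall fun x =>
      (h ▸ Set.mem_univ _ : (WithLp.toLp 2 (x, 0) : HypTimesReal) ∈ verticalOver γ)
    rwa [← this]

end HypTimesReal

theorem mainTheorem6 (S : Set HypTimesReal) :
    (IsTotallyGeodesic S ∧ ¬ IsTrivialSubset S) ↔ (IsHorizontalPlane S ∨ IsVerticalPlane S) := by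
  constructor
  · rintro ⟨hTG, hnt⟩
    have hS := hTG.closedUnderLines HypTimesReal.uniqueBetween HypTimesReal.nonBranching
      HypTimesReal.hasLines
    by_cases h : ∀ x r r', WithLp.toLp 2 (x, r) ∈ S → WithLp.toLp 2 (x, r') ∈ S → r = r'
    · exact Or.inl (HypTimesReal.isHorizontalPlane_of_graph hTG hS hnt h)
    · push Not at h
      obtain ⟨x, r, r', h1, h2, hr⟩ := h
      exact Or.inr (HypTimesReal.isVerticalPlane_of_fibre hS hnt hr h1 h2)
  · rintro (⟨r, rfl⟩ | ⟨γ, hγ, rfl⟩)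
    · exact ⟨HypTimesReal.isTotallyGeodesic_horizontalPlane r,
        HypTimesReal.not_isTrivialSubset_horizontalPlane r⟩
    · exact ⟨HypTimesReal.isTotallyGeodesic_verticalOver hγ,
        HypTimesReal.not_isTrivialSubset_verticalOver hγ⟩
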